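/- Let $H\neq\{0\}$ be a complex Hilbert space. For a unital operator space $\mathcal X\subseteq B(H)$ let $C^*(\mathcal X)$ be the unital C$^*$-algebra it generates in $B(H)$. A boundary representation for $\mathcal X$ is an irreducible unital representation $\rho:C^*(\mathcal X)\to B(H_\rho)$ such that the only unital completely positive map $\psi:C^*(\mathcal X)\to B(H_\rho)$ with $\psi|_{\mathcal X}=\rho|_{\mathcal X}$ is $\psi=\rho$. The Šilov ideal $\mathfrak S_{\mathcal X}$ is the intersection of the kernels of all boundary representations. One says that $\mathcal X$ has a noncommutative Choquet boundary if the quotient map $C^*(\mathcal X)\to C^*(\mathcal X)/\mathfrak S_{\mathcal X}$ is completely isometric on $\mathcal X$; then $C^*_{\rm e}(\mathcal X)=C^*(\mathcal X)/\mathfrak S_{\mathcal X}$ is the C$^*$-envelope of $\mathcal X$. Let $N\in B(H)$ be normal, let $\mathcal S_N=\operatorname{Span}\{1,N,N^*\}\subseteq B(H)$, and let $\mathfrak F_N=\operatorname{Span}\{1,z,\bar z\}\subseteq C(\sigma(N))$, where $z$ is the coordinate function on the spectrum $\sigma(N)$ (the Gelfand transform of $N$). A boundary for $\mathfrak F_N$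 is a closed set $\Omega_0\subseteq\sigma(N)$ such that every $f\in\mathfrak F_N$ satisfies $\|f\|=|f(t)|$ for some $t\in\Omega_0$. Then $\mathcal S_N$ has a noncommutative Choquet boundary; among the boundaries for $\mathfrak F_N$ there is a smallest one, the Šilov boundary $\partial_{\text{Š}}\mathfrak F_N$ (it is the intersection of all boundaries); and $$C^*_{\rm e}(\mathcal S_N)\;\cong\;C(\partial_{\text{Š}}\mathfrak F_N)$$ as C$^*$-algebras, by a $*$-isomorphism that sends the image of $N$ in $C^*_{\rm e}(\mathcal S_N)$ to the coordinate function $z|_{\partial_{\text{Š}}\mathfrak F_N}$. -/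

import Mathlib

/-! ### The quotient of a C⋆-algebra by a closed two-sided ideal -/

namespace CStarQuotient

/-- A closed two-sided ideal containing `z⋆z` has elements `e` with `z (1 - e)` small. -/
theorem exists_approx {A : Type*} [CStarAlgebra A] (I : Ideal A) [I.IsTwoSided] (z : A)
    (hz : star z * z ∈ I) {t : ℝ} (ht : 0 < t) :
    ∃ u : A, 1 - u ∈ I ∧ star u = u ∧ ‖u‖ ≤ 1 ∧ ‖z * u‖ ^ 2 ≤ t := by
  have hsa : IsSelfAdjoint (star z * z) := IsSelfAdjoint.star_mul_self z
  have hpos : ∀ x ∈ spectrum ℝ (star z * z), 0 ≤ x := fun _ hx => spectrum_star_mul_self_nonneg _ hx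
  have hne : ∀ x ∈ spectrum ℝ (star z * z), x + t ≠ 0 := fun x hx => by
    have := hpos x hx
    positivity
  have hc : ContinuousOn (fun x : ℝ => t / (x + t)) (spectrum ℝ (star z * z)) :=
    ContinuousOn.div (by fun_prop) (by fun_prop) hne
  have hd : ContinuousOn (fun x : ℝ => 1 / (x + t)) (spectrum ℝ (star z * z)) :=
    ContinuousOn.div (by fun_prop) (by fun_prop) hne
  have hu : IsSelfAdjoint (cfc (fun x : ℝ => t / (x + t)) (star z * z)) := cfc_predicate _ _
  refine ⟨cfc (fun x : ℝ => t / (x + t)) (star z * z), ?_, hu.star_eq, ?_, ?_⟩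
  · have h1 : (1 : A) - cfc (fun x : ℝ => t / (x + t)) (star z * z)
        = cfc (fun x : ℝ => 1 / (x + t)) (star z * z) * (star z * z) := by
      have e1 : (1 : A) = cfc (fun _ : ℝ => (1 : ℝ)) (star z * z) := by
        rw [cfc_const_one ℝ (star z * z)]
      conv_lhs => rw [e1, ← cfc_sub _ _ _ (by fun_prop) hc]
      have e2 : cfc (fun x : ℝ => 1 / (x + t)) (star z * z) * (star z * z)
          = cfc (fun x : ℝ => 1 / (x + t) * x) (star z * z) := by
        rw [cfc_mul (fun x : ℝ => 1 / (x + t)) (fun x : ℝ => x) _ hd continuousOn_id,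
          cfc_id' ℝ (star z * z)]
      rw [e2]
      refine cfc_congr fun x hx => ?_
      have := hne x hx
      field_simp
      ring
    rw [h1]
    exact I.mul_mem_left _ hz
  · refine norm_cfc_le zero_le_one fun x hx => ?_
    have := hpos x hx
    rw [Real.norm_of_nonneg (by positivity), div_le_one (by positivity)]
    linarith
  · have h2 : ‖z * cfc (fun x : ℝ => t / (x + t)) (star z * z)‖ ^ 2
        = ‖cfc (fun x : ℝ => t / (x + t) * x * (t / (x + t))) (star z * z)‖ := by
      rw [cfc_mul (fun x : ℝ => t / (x + t) * x) (fun x : ℝ => t / (x + t)) _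
          (hc.mul continuousOn_id) hc,
        cfc_mul (fun x : ℝ => t / (x + t)) (fun x : ℝ => x) _ hc continuousOn_id,
        cfc_id' ℝ (star z * z), sq, ← CStarRing.norm_star_mul_self, star_mul, hu.star_eq]
      simp only [mul_assoc]
    rw [h2]
    refine norm_cfc_le ht.le fun x hx => ?_
    have := hpos x hx
    rw [Real.norm_of_nonneg (by positivity)]
    rw [div_mul_eq_mul_div, div_mul_div_comm, div_le_iff₀ (by positivity)]
    nlinarith [mul_nonneg ht.le (mul_nonneg this this), mul_nonneg (mul_nonneg ht.le ht.le) this,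
      mul_nonneg ht.le (mul_nonneg ht.le ht.le)]

variable {A : Type*} [CStarAlgebra A] (I : Ideal A) [I.IsTwoSided]

/-- A closed two-sided ideal of a C⋆-algebra is closed under the involution. -/
theorem star_mem [hI : IsClosed (I : Set A)] {x : A} (hx : x ∈ I) : star x ∈ I := by
  rw [← SetLike.mem_coe, ← hI.closure_eq, Metric.mem_closure_iff]
  intro ε hε
  obtain ⟨u, hu, -, -, hn⟩ := exists_approx I (star x)
    (by rw [star_star]; exact I.mul_mem_right _ hx) (t := (ε / 2) ^ 2) (by positivity)
  refine ⟨star x * (1 - u), I.mul_mem_left _ hu, ?_⟩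
  rw [dist_eq_norm, mul_sub, mul_one, sub_sub_cancel]
  exact (abs_le_of_sq_le_sq' hn (by positivity)).2.trans_lt (by linarith)

theorem star_rel [IsClosed (I : Set A)] {x y : A} (h : Submodule.quotientRel I x y) :
    Submodule.quotientRel I (star x) (star y) := by
  rw [Submodule.quotientRel_def] at h ⊢
  rw [← star_sub]
  exact star_mem I h

noncomputable instance instNormedRing [IsClosed (I : Set A)] : NormedRing (A ⧸ I) where
  __ := Ideal.Quotient.ring I
  __ := Submodule.Quotient.normedAddCommGroup I
  norm_mul_le x y := by
    refine le_of_forall_gt_imp_ge_of_dense fun c hc => ?_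
    have hcont : Filter.Tendsto (fun ε : ℝ => (‖x‖ + ε) * (‖y‖ + ε)) (nhdsWithin 0 (Set.Ioi 0))
        (nhds (‖x‖ * ‖y‖)) := by
      have : Continuous fun ε : ℝ => (‖x‖ + ε) * (‖y‖ + ε) := by fun_prop
      simpa using (this.tendsto 0).mono_left nhdsWithin_le_nhds
    obtain ⟨ε, h1, h2⟩ := ((hcont.eventually_lt_const hc).and self_mem_nhdsWithin).exists
    obtain ⟨a, rfl, ha⟩ := Submodule.Quotient.norm_mk_lt x h2
    obtain ⟨b, rfl, hb⟩ := Submodule.Quotient.norm_mk_lt y h2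
    calc _ ≤ ‖a * b‖ := Submodule.Quotient.norm_mk_le I (a * b)
      _ ≤ ‖a‖ * ‖b‖ := norm_mul_le a b
      _ ≤ _ := mul_le_mul ha.le hb.le (norm_nonneg _) ((norm_nonneg _).trans ha.le)
      _ ≤ c := h1.le

noncomputable instance instNormedAlgebra [IsClosed (I : Set A)] : NormedAlgebra ℂ (A ⧸ I) where
  __ := Ideal.Quotient.algebra (I := I) ℂ
  norm_smul_le := (Submodule.Quotient.normedSpace I ℂ).norm_smul_le

/-- The involution on the quotient: `(a + I)⋆ = a⋆ + I`. -/
noncomputable instance instStarRing [IsClosed (I : Set A)] : StarRing (A ⧸ I) where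
  star := Quotient.map' star fun _ _ h => star_rel I h
  star_involutive := by
    rintro ⟨x⟩
    exact congrArg (Ideal.Quotient.mk I) (star_star x)
  star_mul := by
    rintro ⟨x⟩ ⟨y⟩
    exact congrArg (Ideal.Quotient.mk I) (star_mul x y)
  star_add := by
    rintro ⟨x⟩ ⟨y⟩
    exact congrArg (Ideal.Quotient.mk I) (star_add x y)

/-- The quotient `A ⧸ I` with the quotient norm is a C⋆-algebra. -/
noncomputable instance instCStarAlgebra [IsClosed (I : Set A)] : CStarAlgebra (A ⧸ I) where
  toCompleteSpace := Submodule.Quotient.completeSpace I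
  star_smul := by
    rintro c ⟨x⟩
    exact congrArg (Ideal.Quotient.mk I) (star_smul c x)
  norm_mul_self_le := by
    rintro ⟨x⟩
    change ‖Ideal.Quotient.mk I x‖ * ‖Ideal.Quotient.mk I x‖ ≤ ‖Ideal.Quotient.mk I (star x * x)‖
    refine le_of_forall_pos_le_add fun ε hε => ?_
    obtain ⟨w, hw, hwn⟩ :=
      Submodule.Quotient.norm_mk_lt (Ideal.Quotient.mk I (star x * x)) (half_pos hε)
    have hy : w - star x * x ∈ I := (Ideal.Quotient.eq (I := I)).1 hw
    obtain ⟨u, hu, hsu, hu1, hn⟩ := exists_approx I (w - star x * x) (I.mul_mem_left _ hy)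
      (t := (ε / 2) ^ 2) (by positivity)
    have hn' : ‖(w - star x * x) * u‖ ≤ ε / 2 := (abs_le_of_sq_le_sq' hn (by positivity)).2
    have hxu : ‖Ideal.Quotient.mk I x‖ ≤ ‖x * u‖ := by
      have : Ideal.Quotient.mk I x = Ideal.Quotient.mk I (x * u) := by
        rw [Ideal.Quotient.eq, ← mul_one_sub]
        exact I.mul_mem_left _ hu
      rw [this]
      exact Submodule.Quotient.norm_mk_le I (x * u)
    calc ‖Ideal.Quotient.mk I x‖ * ‖Ideal.Quotient.mk I x‖ ≤ ‖x * u‖ * ‖x * u‖ :=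
          mul_le_mul hxu hxu (norm_nonneg _) (norm_nonneg _)
      _ = ‖u * w * u - u * ((w - star x * x) * u)‖ := by
          rw [← CStarRing.norm_star_mul_self, star_mul, hsu]
          congr 1
          noncomm_ring
      _ ≤ ‖u * w * u‖ + ‖u * ((w - star x * x) * u)‖ := norm_sub_le _ _
      _ ≤ 1 * ‖w‖ * 1 + 1 * (ε / 2) := by
          gcongr
          · exact (norm_mul_le _ _).trans (mul_le_mul ((norm_mul_le _ _).trans (by gcongr)) hu1
              (norm_nonneg _) (by positivity))
          · exact (norm_mul_le _ _).trans (by gcongr)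
      _ ≤ ‖Ideal.Quotient.mk I (star x * x)‖ + ε := by linarith

end CStarQuotient

/-! ### Unital operator spaces and complete isometries -/

section OperatorSpaces

variable {H : Type*} [NormedAddCommGroup H] [InnerProductSpace ℂ H] [CompleteSpace H]

/-- `C⋆(X)`, the unital C⋆-subalgebra of `B(H)` generated by `X`. -/
noncomputable def cstarGen (X : Submodule ℂ (H →L[ℂ] H)) : StarSubalgebra ℂ (H →L[ℂ] H) :=
  (StarAlgebra.adjoin ℂ (X : Set (H →L[ℂ] H))).topologicalClosure

instance (X : Submodule ℂ (H →L[ℂ] H)) : IsClosed (cstarGen X : Set (H →L[ℂ] H)) :=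
  StarSubalgebra.isClosed_topologicalClosure _

theorem le_cstarGen (X : Submodule ℂ (H →L[ℂ] H)) {x : H →L[ℂ] H} (hx : x ∈ X) :
    x ∈ cstarGen X :=
  StarSubalgebra.le_topologicalClosure _ (StarAlgebra.subset_adjoin ℂ _ hx)

/-- The inclusion `X → C⋆(X)`. -/
noncomputable def inclGen (X : Submodule ℂ (H →L[ℂ] H)) : X →ₗ[ℂ] cstarGen X where
  toFun x := ⟨x, le_cstarGen X x.2⟩
  map_add' _ _ := rfl
  map_smul' _ _ := rfl

/-- The order which `C⋆(X)` inherits from `B(H)` is its C⋆-algebra order. -/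
instance (X : Submodule ℂ (H →L[ℂ] H)) : StarOrderedRing (cstarGen X) := by
  refine StarOrderedRing.of_le_iff fun x y => ⟨fun h => ?_, ?_⟩
  · have h0 : (0 : H →L[ℂ] H) ≤ ((y - x : cstarGen X) : H →L[ℂ] H) := sub_nonneg.2 h
    have hsa : IsSelfAdjoint (y - x) := Subtype.ext (IsSelfAdjoint.of_nonneg h0).star_eq
    have hsp : SpectrumRestricts (y - x) ContinuousMap.realToNNReal := by
      rw [SpectrumRestricts.nnreal_iff]
      intro r hr
      refine spectrum_nonneg_of_nonneg h0 ?_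
      rw [← spectrum.preimage_algebraMap ℂ] at hr ⊢
      rwa [Set.mem_preimage, StarSubalgebra.spectrum_eq] at hr
    obtain ⟨s, hs, -, hs2⟩ := CFC.exists_sqrt_of_isSelfAdjoint_of_quasispectrumRestricts hsa hsp
    exact ⟨s, by rw [hs.star_eq, hs2]; abel⟩
  · rintro ⟨s, rfl⟩
    change (x : H →L[ℂ] H) ≤ x + star (s : H →L[ℂ] H) * s
    exact le_add_of_nonneg_right (star_mul_self_nonneg _)


/-- A linear map `φ` from a subspace `X ⊆ B(H)` to a C⋆-algebra is a complete isometry if for every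
`n` its entrywise amplification `Mₙ(X) → Mₙ(B)` preserves the C⋆-norm of matrices. -/
def IsCompleteIsometry {X : Submodule ℂ (H →L[ℂ] H)} {B : Type*} [CStarAlgebra B] [PartialOrder B]
    [StarOrderedRing B] (φ : X →ₗ[ℂ] B) : Prop :=
  ∀ (n : ℕ) (M : Matrix (Fin n) (Fin n) X),
    ‖CStarMatrix.ofMatrix (M.map fun x => φ x)‖ =
      ‖CStarMatrix.ofMatrix (M.map fun x => (x : H →L[ℂ] H))‖

end OperatorSpaces

/-! ### Boundary representations, the Šilov ideal and the C⋆-envelope -/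

section Boundary

open scoped CStarAlgebra

/-- A representation on a Hilbert space is irreducible if the space is nonzero and the only closed
invariant subspaces are the trivial ones. -/
def IsIrreducibleRep {A : Type*} [CStarAlgebra A] {K : Type*} [NormedAddCommGroup K]
    [InnerProductSpace ℂ K] [CompleteSpace K] (ρ : A →⋆ₐ[ℂ] (K →L[ℂ] K)) : Prop :=
  Nontrivial K ∧ ∀ V : Submodule ℂ K, IsClosed (V : Set K) → (∀ a, ∀ v ∈ V, ρ a v ∈ V) →
    V = ⊥ ∨ V = ⊤

universe u

variable {H : Type u} [NormedAddCommGroup H] [InnerProductSpace ℂ H] [CompleteSpace H]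

/-- A boundary representation for `X`: an irreducible representation `ρ` of `C⋆(X)` such that the
only unital completely positive map on `C⋆(X)` which agrees with `ρ` on `X` is `ρ` itself. -/
def IsBoundaryRep (X : Submodule ℂ (H →L[ℂ] H)) {K : Type*} [NormedAddCommGroup K]
    [InnerProductSpace ℂ K] [CompleteSpace K] (ρ : cstarGen X →⋆ₐ[ℂ] (K →L[ℂ] K)) : Prop :=
  IsIrreducibleRep ρ ∧
    ∀ ψ : cstarGen X →CP (K →L[ℂ] K), ψ 1 = 1 → (∀ x : X, ψ (inclGen X x) = ρ (inclGen X x)) →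
      ∀ a, ψ a = ρ a

/-- The Šilov ideal of `X`: the intersection of the kernels of all boundary representations.
An irreducible representation of `C⋆(X)` acts on a Hilbert space which is a completion of a quotient
of `C⋆(X)`, so letting `K` range over the universe of `H` reaches every unitary equivalence class. -/
def silovIdeal (X : Submodule ℂ (H →L[ℂ] H)) : Ideal (cstarGen X) where
  carrier := {a | ∀ (K : Type u) [NormedAddCommGroup K] [InnerProductSpace ℂ K] [CompleteSpace K]
    (ρ : cstarGen X →⋆ₐ[ℂ] (K →L[ℂ] K)), IsBoundaryRep X ρ → ρ a = 0}
  add_mem' ha hb K _ _ _ ρ hρ := by rw [map_add, ha K ρ hρ, hb K ρ hρ, add_zero]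
  zero_mem' K _ _ _ ρ _ := map_zero ρ
  smul_mem' c a ha K _ _ _ ρ hρ := by rw [smul_eq_mul, map_mul, ha K ρ hρ, mul_zero]

instance (X : Submodule ℂ (H →L[ℂ] H)) : (silovIdeal X).IsTwoSided where
  mul_mem_of_left {a} b ha K _ _ _ ρ hρ := by rw [map_mul, ha K ρ hρ, zero_mul]

instance (X : Submodule ℂ (H →L[ℂ] H)) : IsClosed (silovIdeal X : Set (cstarGen X)) := by
  have h : (silovIdeal X : Set (cstarGen X)) =
      ⋂ (K : Type u) (_ : NormedAddCommGroup K) (_ : InnerProductSpace ℂ K) (_ : CompleteSpace K)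
        (ρ : cstarGen X →⋆ₐ[ℂ] (K →L[ℂ] K)) (_ : IsBoundaryRep X ρ), {a | ρ a = 0} := by
    ext a
    simp only [Set.mem_iInter]
    rfl
  rw [h]
  refine isClosed_iInter fun K => isClosed_iInter fun _ => isClosed_iInter fun _ =>
    isClosed_iInter fun _ => isClosed_iInter fun ρ => isClosed_iInter fun _ => ?_
  exact isClosed_eq (map_continuous ρ) continuous_const

/-- The C⋆-envelope `C⋆(X) / 𝔖_X`, with its C⋆-algebra structure as a quotient. -/
abbrev CStarEnvelope (X : Submodule ℂ (H →L[ℂ] H)) : Type u :=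
  cstarGen X ⧸ silovIdeal X

/-- The C⋆-algebra order of the C⋆-envelope: `x ≤ y` iff `y - x` is positive. -/
noncomputable instance (X : Submodule ℂ (H →L[ℂ] H)) : PartialOrder (CStarEnvelope X) :=
  CStarAlgebra.spectralOrder _

instance (X : Submodule ℂ (H →L[ℂ] H)) : StarOrderedRing (CStarEnvelope X) :=
  CStarAlgebra.spectralOrderedRing _

/-- The canonical map `X → C⋆(X) → C⋆(X) / 𝔖_X`. -/
noncomputable def toEnvelope (X : Submodule ℂ (H →L[ℂ] H)) : X →ₗ[ℂ] CStarEnvelope X :=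
  (Ideal.Quotient.mkₐ ℂ (silovIdeal X)).toLinearMap ∘ₗ inclGen X

/-- `X` has a noncommutative Choquet boundary if the quotient map `C⋆(X) → C⋆(X) / 𝔖_X` is a
complete isometry on `X`. -/
def HasNoncommutativeChoquetBoundary (X : Submodule ℂ (H →L[ℂ] H)) : Prop :=
  IsCompleteIsometry (toEnvelope X)

/-- The operator system `𝒮_T = Span {1, T, T⋆}`. -/
noncomputable def operatorSystem (T : H →L[ℂ] H) : Submodule ℂ (H →L[ℂ] H) :=
  Submodule.span ℂ {1, T, star T}

/-- `T` as an element of `𝒮_T`. -/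
noncomputable def operatorSystem.gen (T : H →L[ℂ] H) : operatorSystem T :=
  ⟨T, Submodule.subset_span (by simp)⟩

end Boundary

/-! ### Function systems and the Šilov boundary -/

section FunctionSystems

variable {Ω : Type*} [TopologicalSpace Ω] [CompactSpace Ω]

/-- A boundary for a set `F` of continuous functions: a closed set on which every member of `F`
attains its norm. -/
def IsFunctionBoundary (F : Set C(Ω, ℂ)) (B : Set Ω) : Prop :=
  IsClosed B ∧ ∀ f ∈ F, ∃ t ∈ B, ‖f‖ = ‖f t‖

/-- The Šilov boundary: the intersection of all boundaries (so that it is the smallest boundary as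
soon as it is a boundary). -/
def silovBoundary (F : Set C(Ω, ℂ)) : Set Ω :=
  ⋂₀ {B | IsFunctionBoundary F B}

/-- The coordinate function `z ↦ z` on the spectrum of `N`. For a normal `N` it is the Gelfand
transform of `N`, under the identification of the characters of `C⋆(N)` with the points of
the spectrum. -/
noncomputable def coordFn {A : Type*} [CStarAlgebra A] (N : A) : C(spectrum ℂ N, ℂ) :=
  ⟨Subtype.val, continuous_subtype_val⟩

/-- The function system `𝔉_N = Span {1, z, z̄}` on the spectrum of `N`. -/
noncomputable def functionSystem {A : Type*} [CStarAlgebra A] (N : A) :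
    Submodule ℂ C(spectrum ℂ N, ℂ) :=
  Submodule.span ℂ {1, coordFn N, star (coordFn N)}

end FunctionSystems

/-! ### Convex hulls of compact sets in finite dimension -/

/-! The Gelfand transform identifies `C⋆(𝒮_N)` with `C(σ(N))` and carries `𝒮_N` into `Span {1, z,
z̄}`. Members of that span are restrictions of real-affine maps on `ℂ`, so everything is governed by
the set `E` of points of `σ(N)` that are extreme in `conv σ(N)`. By Carathéodory and Krein–Milman
each point of `σ(N)` is a finite convex combination of points of `closure E`. Hence `closure E` is a
boundary; separation by half-planes puts `E` inside every boundary, so `closure E` is the Šilov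
boundary.

The Šilov ideal is the ideal of functions vanishing on `closure E`, by two inclusions. A state on
`C(σ(N))` whose barycentre is a point of `E` is evaluation there
(`state_eq_eval_of_mem_extremeSpectrum`), so the points of `E` give boundary representations.
Conversely, an irreducible representation is evaluation at some point `x`. Writing `x` as a convex
combination from `closure E` gives a unital completely positive map that agrees with it on `𝒮_N`; a
boundary representation must equal that map, and so kills functions vanishing on `closure E`.

The quotient is therefore `C(closure E)`. Complete isometry is again the convex combination, applied
to matrices. -/

theorem Function.Embedding.sum_extend_zero {ι κ M : Type*} [Fintype ι] [Fintype κ] [AddCommMonoid M]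
    (e : ι ↪ κ) (h : ι → M) : ∑ i, Function.extend e h 0 i = ∑ j, h j := by
  classical
  rw [← Finset.sum_subset (Finset.subset_univ (Finset.univ.map e))]
  · simp [e.injective.extend_apply]
  · intro i _ hi
    rw [Function.extend_apply']
    · rfl
    · simpa using hi

/-- The convex hull of a compact set in a finite-dimensional real space is compact. -/
theorem IsCompact.convexHull_of_finiteDimensional {E : Type*} [AddCommGroup E] [Module ℝ E]
    [TopologicalSpace E] [IsTopologicalAddGroup E] [ContinuousSMul ℝ E] [FiniteDimensional ℝ E]
    {s : Set E} (hs : IsCompact s) : IsCompact (convexHull ℝ s) := by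
  -- By Carathéodory, `finrank + 1` points always suffice, so the hull is the continuous image of a
  -- simplex times a finite power of `s`.
  have hK : IsCompact ((stdSimplex ℝ (Fin (Module.finrank ℝ E + 1))) ×ˢ
      (Set.univ.pi fun _ : Fin (Module.finrank ℝ E + 1) => s)) :=
    (isCompact_stdSimplex ℝ _).prod (isCompact_univ_pi fun _ => hs)
  have hc : Continuous fun p : (Fin (Module.finrank ℝ E + 1) → ℝ) ×
      (Fin (Module.finrank ℝ E + 1) → E) => ∑ i, p.1 i • p.2 i := by fun_prop
  convert hK.image hc using 1
  refine Set.Subset.antisymm (fun x hx => ?_) ?_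
  · rw [convexHull_eq_union] at hx
    simp only [Set.mem_iUnion] at hx
    obtain ⟨t, hts, hind, hxt⟩ := hx
    have hcard : Fintype.card t ≤ Fintype.card (Fin (Module.finrank ℝ E + 1)) := by
      rw [Fintype.card_fin]
      exact hind.card_le_finrank_succ.trans (Nat.succ_le_succ (Submodule.finrank_le _))
    obtain ⟨e⟩ := Function.Embedding.nonempty_of_card_le hcard
    have hne : t.Nonempty := by
      rw [← Finset.coe_nonempty, ← convexHull_nonempty_iff (𝕜 := ℝ)]
      exact ⟨x, hxt⟩
    have : Nonempty t := hne.coe_sort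
    rw [Finset.mem_convexHull'] at hxt
    obtain ⟨w, hw0, hw1, hwx⟩ := hxt
    -- When fewer points are needed, the spare indices get weight `0` and an arbitrary point of `t`.
    refine ⟨(Function.extend e (fun j => w j) 0, fun i => (Function.invFun e i : t)),
      ⟨⟨fun i => ?_, ?_⟩, fun i _ => hts (Function.invFun e i).2⟩, ?_⟩
    · change 0 ≤ Function.extend e (fun j : t => w j) 0 i
      by_cases h : ∃ j, e j = i
      · obtain ⟨j, rfl⟩ := h
        rw [e.injective.extend_apply]
        exact hw0 _ j.2
      · rw [Function.extend_apply' _ _ _ h]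
        exact le_rfl
    · rw [e.sum_extend_zero, ← hw1, ← Finset.sum_coe_sort t]
    · rw [← hwx, ← Finset.sum_coe_sort t, ← e.sum_extend_zero]
      refine Finset.sum_congr rfl fun i _ => ?_
      by_cases h : ∃ j, e j = i
      · obtain ⟨j, rfl⟩ := h
        simp only [e.injective.extend_apply, Function.leftInverse_invFun e.injective j]
      · simp only [Function.extend_apply' _ _ _ h, Pi.zero_apply, zero_smul]
  · rintro _ ⟨⟨w, z⟩, ⟨⟨hw0, hw1⟩, hz⟩, rfl⟩
    exact mem_convexHull_of_exists_fintype w z hw0 hw1 (fun i => hz i trivial) rfl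

/-- A compact set lies in the convex hull of the closure of the extreme points of its convex
hull. -/
theorem IsCompact.subset_convexHull_closure_extremePoints {E : Type*} [AddCommGroup E] [Module ℝ E]
    [TopologicalSpace E] [IsTopologicalAddGroup E] [ContinuousSMul ℝ E] [FiniteDimensional ℝ E]
    [T2Space E] [LocallyConvexSpace ℝ E] {s : Set E} (hs : IsCompact s) :
    s ⊆ convexHull ℝ (closure ((convexHull ℝ s).extremePoints ℝ)) := by
  have hsub : closure ((convexHull ℝ s).extremePoints ℝ) ⊆ s :=
    closure_minimal extremePoints_convexHull_subset hs.isClosed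
  have hcl : IsClosed (convexHull ℝ (closure ((convexHull ℝ s).extremePoints ℝ))) :=
    (hs.of_isClosed_subset isClosed_closure hsub).convexHull_of_finiteDimensional.isClosed
  refine (subset_convexHull ℝ s).trans ?_
  -- Krein–Milman; the hull of the closed set of extreme points is already closed, so no further
  -- closure is needed.
  conv_lhs => rw [← closure_convexHull_extremePoints hs.convexHull_of_finiteDimensional
    (convex_convexHull ℝ s)]
  exact closure_minimal (convexHull_mono subset_closure) hcl

/-- A point outside the convex hull of a compact set is strictly separated from that set by a
real-linear functional. -/
theorem Complex.exists_re_mul_lt_of_notMem_convexHull {s : Set ℂ} (hs : IsCompact s) {w : ℂ}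
    (hw : w ∉ convexHull ℝ s) : ∃ (c : ℂ) (r : ℝ), (∀ z ∈ s, (c * z).re < r) ∧ r < (c * w).re := by
  obtain ⟨f, r, hlt, hr⟩ := geometric_hahn_banach_closed_point (convex_convexHull ℝ s)
    hs.convexHull_of_finiteDimensional.isClosed hw
  have hf : ∀ z : ℂ, (((f 1 : ℝ) - (f Complex.I : ℝ) * Complex.I : ℂ) * z).re = f z := fun z => by
    have hz : z = z.re • (1 : ℂ) + z.im • Complex.I := by simp [Complex.re_add_im]
    conv_rhs => rw [hz, map_add, map_smul, map_smul]
    simp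
    ring
  exact ⟨_, r, fun z hz => by rw [hf]; exact hlt z (subset_convexHull ℝ s hz), by rwa [hf]⟩

/-! ### The Šilov boundary of `Span {1, z, z̄}` -/

section FunctionSystem

variable {A : Type*} [CStarAlgebra A] (N : A)

/-- The points of the spectrum of `N` that are extreme in its convex hull. -/
def extremeSpectrum : Set (spectrum ℂ N) :=
  {t | (t : ℂ) ∈ (convexHull ℝ (spectrum ℂ N)).extremePoints ℝ}

theorem exists_eq_of_mem_functionSystem {N : A} {f : C(spectrum ℂ N, ℂ)}
    (hf : f ∈ functionSystem N) :
    ∃ a b c : ℂ, ∀ t, f t = a + b * t + c * star (t : ℂ) := by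
  obtain ⟨a, b, c, rfl⟩ := Submodule.mem_span_triple.1 hf
  exact ⟨a, b, c, fun t => by simp [coordFn]⟩

theorem mem_functionSystem_of_eq {N : A} (f : C(spectrum ℂ N, ℂ)) {a b c : ℂ}
    (h : ∀ t, f t = a + b * t + c * star (t : ℂ)) : f ∈ functionSystem N :=
  Submodule.mem_span_triple.2 ⟨a, b, c, by ext t; simp [coordFn, h]⟩

/-- Every point of the spectrum is represented on `Span {1, z, z̄}` by a convex combination of
evaluations at points in the closure of the extreme points. -/
theorem exists_convexCombination_functionSystem (t : spectrum ℂ N) :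
    ∃ (ι : Type) (_ : Fintype ι) (w : ι → ℝ) (e : ι → spectrum ℂ N), (∀ i, 0 ≤ w i) ∧
      ∑ i, w i = 1 ∧ (∀ i, e i ∈ closure (extremeSpectrum N)) ∧
      ∀ f ∈ functionSystem N, f t = ∑ i, (w i : ℂ) * f (e i) := by
  obtain ⟨ι, _, w, z, hw0, hw1, hz, hzt⟩ := mem_convexHull_iff_exists_fintype.1
    ((spectrum.isCompact N).subset_convexHull_closure_extremePoints t.2)
  have hcl : ∀ i, z i ∈ spectrum ℂ N := fun i =>
    closure_minimal extremePoints_convexHull_subset (spectrum.isCompact N).isClosed (hz i)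
  refine ⟨ι, inferInstance, w, fun i => ⟨z i, hcl i⟩, hw0, hw1, fun i => ?_, fun f hf => ?_⟩
  · rw [closure_subtype]
    convert hz i using 2
    exact Set.Subset.antisymm (by rintro _ ⟨x, hx, rfl⟩; exact hx)
      fun x hx => ⟨⟨x, extremePoints_convexHull_subset hx⟩, hx, rfl⟩
  · obtain ⟨a, b, c, h⟩ := exists_eq_of_mem_functionSystem hf
    have hw1' : ∑ i, (w i : ℂ) = 1 := by exact_mod_cast hw1
    simp only [Complex.real_smul] at hzt
    -- The weights are real, so the same combination represents `z̄`.
    have hst : star (t : ℂ) = ∑ i, (w i : ℂ) * star (z i) := by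
      rw [← hzt, star_sum]
      exact Finset.sum_congr rfl fun i _ => by simp
    calc f t = a * ∑ i, (w i : ℂ) + b * ∑ i, (w i : ℂ) * z i
          + c * ∑ i, (w i : ℂ) * star (z i) := by rw [h, hst, hzt, hw1', mul_one]
      _ = _ := by
        simp only [h, Finset.mul_sum, ← Finset.sum_add_distrib]
        exact Finset.sum_congr rfl fun i _ => by ring

/-- If `t` were outside `conv B`, a functional `Re (c z)` would be larger at `t` than anywhere on
`B`; shifted to be nonnegative, it is a member of the system whose norm is not attained on `B`. So
`t ∈ conv B`, and being extreme in the larger hull it is extreme in `conv B`, hence a point of `B`.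
-/
theorem extremeSpectrum_subset_of_isFunctionBoundary {N : A} {B : Set (spectrum ℂ N)}
    (hB : IsFunctionBoundary (functionSystem N : Set C(spectrum ℂ N, ℂ)) B) :
    extremeSpectrum N ⊆ B := by
  intro t ht
  have hBc : IsCompact (Subtype.val '' B : Set ℂ) :=
    hB.1.isCompact.image continuous_subtype_val
  have hsub : (Subtype.val '' B : Set ℂ) ⊆ spectrum ℂ N := by rintro _ ⟨x, -, rfl⟩; exact x.2
  have hmem : (t : ℂ) ∈ convexHull ℝ (Subtype.val '' B : Set ℂ) := by
    by_contra hcon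
    obtain ⟨c, r, hlt, hr⟩ := Complex.exists_re_mul_lt_of_notMem_convexHull hBc hcon
    -- A bound for `|Re (c z)|` on the spectrum: adding it makes the function nonnegative, so that
    -- its modulus is its value.
    set m : ℝ := ‖c‖ * ‖coordFn N‖
    have hm : ∀ x : spectrum ℂ N, |(c * x).re| ≤ m := fun x =>
      (Complex.abs_re_le_norm _).trans <| by
        rw [norm_mul]
        exact mul_le_mul_of_nonneg_left ((coordFn N).norm_coe_le_norm x) (norm_nonneg _)
    let f : C(spectrum ℂ N, ℂ) := ⟨fun x => ((c * x).re + m : ℝ), by fun_prop⟩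
    have hf : f ∈ functionSystem N := mem_functionSystem_of_eq f (a := m) (b := c / 2)
      (c := star c / 2) fun x => by
        have := Complex.re_eq_add_conj (c * x)
        simp only [f, ContinuousMap.coe_mk, Complex.ofReal_add, this, map_mul]
        simp only [RCLike.star_def]
        ring
    obtain ⟨x, hx, hfx⟩ := hB.2 f hf
    have hfn : ∀ x, ‖f x‖ = (c * x).re + m := fun x => by
      simp only [f, ContinuousMap.coe_mk, Complex.norm_real]
      exact Real.norm_of_nonneg (by linarith [neg_le_of_abs_le (hm x)])
    have h1 := f.norm_coe_le_norm t
    rw [hfx, hfn, hfn] at h1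
    linarith [hlt x ⟨x, hx, rfl⟩]
  obtain ⟨x, hx, hxt⟩ := extremePoints_convexHull_subset
    (inter_extremePoints_subset_extremePoints_of_subset (convexHull_mono hsub) ⟨hmem, ht⟩)
  rwa [← Subtype.ext hxt]

/-- `|f t|` is at most a weighted average of the `|f (e i)|`, so some `e i` does at least as well as
`t`; apply this where `|f|` is maximal. -/
theorem isFunctionBoundary_closure_extremeSpectrum [Nontrivial A] :
    IsFunctionBoundary (functionSystem N : Set C(spectrum ℂ N, ℂ))
      (closure (extremeSpectrum N)) := by
  refine ⟨isClosed_closure, fun f hf => ?_⟩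
  have : Nonempty (spectrum ℂ N) := (spectrum.nonempty N).to_subtype
  have hrep : ∀ t, ∃ e ∈ closure (extremeSpectrum N), ‖f t‖ ≤ ‖f e‖ := fun t => by
    obtain ⟨ι, _, w, e, hw0, hw1, he, h⟩ := exists_convexCombination_functionSystem N t
    by_contra! hcon
    have hle : ‖f t‖ ≤ ∑ i, w i * ‖f (e i)‖ := by
      conv_lhs => rw [h f hf]
      refine (norm_sum_le _ _).trans (Finset.sum_le_sum fun i _ => ?_)
      rw [norm_mul, Complex.norm_real, Real.norm_of_nonneg (hw0 i)]
    obtain ⟨j, hj⟩ : ∃ j, 0 < w j := by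
      by_contra! hall
      have := Finset.sum_nonpos fun i (_ : i ∈ Finset.univ) => hall i
      linarith
    have : ∑ i, w i * ‖f (e i)‖ < ∑ i, w i * ‖f t‖ :=
      Finset.sum_lt_sum (fun i _ => mul_le_mul_of_nonneg_left (hcon _ (he i)).le (hw0 i))
        ⟨j, Finset.mem_univ _, mul_lt_mul_of_pos_left (hcon _ (he j)) hj⟩
    rw [← Finset.sum_mul, hw1, one_mul] at this
    linarith
  obtain ⟨t, -, ht⟩ := isCompact_univ.exists_isMaxOn Set.univ_nonempty
    (continuous_norm.comp f.continuous).continuousOn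
  obtain ⟨e, he, hte⟩ := hrep t
  refine ⟨e, he, le_antisymm ?_ (f.norm_coe_le_norm e)⟩
  exact (ContinuousMap.norm_le _ (norm_nonneg _)).2 fun x => (ht (Set.mem_univ x)).trans hte

/-- The Šilov boundary of `Span {1, z, z̄}` is the closure of the set of extreme points. -/
theorem silovBoundary_functionSystem [Nontrivial A] :
    silovBoundary (functionSystem N : Set C(spectrum ℂ N, ℂ)) = closure (extremeSpectrum N) :=
  Set.Subset.antisymm (Set.sInter_subset_of_mem (isFunctionBoundary_closure_extremeSpectrum N))
    (Set.subset_sInter fun _ hB =>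
      closure_minimal (extremeSpectrum_subset_of_isFunctionBoundary hB) hB.1)

end FunctionSystem

/-! ### States with extreme barycentre -/

section States

open scoped ComplexOrder

variable {A : Type*} [CStarAlgebra A] {N : A}

/-- The functional `f ↦ φ (k * f)` is positive of mass `φ k`, and `w` is its barycentre: any
half-plane containing the spectrum contains it. If the mass is zero, then `φ (k * z) = 0` and every
`w` works. -/
theorem exists_state_mul_coordFn [Nontrivial A] (φ : C(spectrum ℂ N, ℂ) →ₚ[ℂ] ℂ)
    {k : C(spectrum ℂ N, ℂ)} (hk : 0 ≤ k) :
    ∃ w ∈ convexHull ℝ (spectrum ℂ N), φ (k * coordFn N) = φ k * w := by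
  obtain ⟨p, hp, hpk⟩ : ∃ p : ℝ, 0 ≤ p ∧ φ k = p := by
    have h := φ.map_nonneg hk
    exact ⟨(φ k).re, (Complex.nonneg_iff.1 h).1, Complex.eq_re_of_ofReal_le (r := 0) (by simpa using h)⟩
  have key : ∀ (c : ℂ) (r : ℝ), (∀ z ∈ spectrum ℂ N, (c * z).re ≤ r) →
      (c * φ (k * coordFn N)).re ≤ r * p := fun c r hr => by
    set g : C(spectrum ℂ N, ℂ) := c • (k * coordFn N)
    have h0 : 0 ≤ (2 * r : ℂ) • k - (g + star g) := fun x => by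
      have hkx : 0 ≤ k x := hk x
      have hks : star (k x) = k x := (IsSelfAdjoint.of_nonneg hkx).star_eq
      have hx : ((2 * r : ℂ) • k - (g + star g)) x = k x * ((2 * (r - (c * x).re) : ℝ) : ℂ) := by
        have h2 := Complex.add_conj (c * (x : ℂ))
        simp only [g, coordFn, ContinuousMap.sub_apply, ContinuousMap.add_apply,
          ContinuousMap.smul_apply, ContinuousMap.star_apply, ContinuousMap.mul_apply,
          ContinuousMap.coe_mk, smul_eq_mul, star_mul, hks]
        push_cast at h2 ⊢
        simp only [map_mul, RCLike.star_def] at h2 ⊢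
        linear_combination (-k x) * h2
      change 0 ≤ ((2 * r : ℂ) • k - (g + star g)) x
      rw [hx]
      exact mul_nonneg hkx (Complex.zero_le_real.2 (by linarith [hr x x.2]))
    have h1 := φ.map_nonneg h0
    rw [map_sub, map_add, map_star, map_smul, hpk] at h1
    have h2 := (Complex.nonneg_iff.1 h1).1
    have h3 : φ g = c * φ (k * coordFn N) := map_smul φ _ _
    simp [h3] at h2
    simp
    linarith
  rcases hp.eq_or_lt with rfl | hp
  · obtain ⟨w, hw⟩ := spectrum.nonempty N
    refine ⟨w, subset_convexHull ℝ _ hw, ?_⟩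
    -- With `c` the conjugate of `φ (k * z)` and zero mass, the half-plane estimate reads `|φ (k *
    -- z)|² ≤ 0`.
    have h := key (star (φ (k * coordFn N))) (‖star (φ (k * coordFn N))‖ * ‖coordFn N‖)
      fun z hz => (Complex.re_le_norm _).trans <| by
        rw [norm_mul]
        exact mul_le_mul_of_nonneg_left ((coordFn N).norm_coe_le_norm ⟨z, hz⟩) (norm_nonneg _)
    rw [mul_zero, RCLike.star_def, ← Complex.normSq_eq_conj_mul_self, Complex.ofReal_re] at h
    rw [hpk, Complex.normSq_eq_zero.1 (le_antisymm h (Complex.normSq_nonneg _))]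
    simp
  · refine ⟨φ (k * coordFn N) / p, ?_, ?_⟩
    · by_contra hcon
      obtain ⟨c, r, hlt, hr⟩ :=
        Complex.exists_re_mul_lt_of_notMem_convexHull (spectrum.isCompact N) hcon
      have := key c r fun z hz => (hlt z hz).le
      rw [← mul_div_assoc, Complex.div_ofReal_re, lt_div_iff₀ hp] at hr
      linarith
    · rw [hpk]
      field_simp [Complex.ofReal_ne_zero.2 hp.ne']

/-- For `0 ≤ h ≤ m`, the splitting `m = h + (m - h)` exhibits `t` as an average of the barycentres
of the two pieces. Extremality forces the barycentre of `h` to be `t` when both masses are positive;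
if either mass vanishes the identity is immediate. Positive elements span. -/
theorem state_mul_coordFn_of_mem_extremeSpectrum [Nontrivial A] (φ : C(spectrum ℂ N, ℂ) →ₚ[ℂ] ℂ)
    (h1 : φ 1 = 1) {t : spectrum ℂ N} (ht : t ∈ extremeSpectrum N) (hφ : φ (coordFn N) = t)
    (f : C(spectrum ℂ N, ℂ)) : φ (f * coordFn N) = φ f * t := by
  suffices h : φ.toLinearMap ∘ₗ LinearMap.mulRight ℂ (coordFn N) = (t : ℂ) • φ.toLinearMap by
    have := LinearMap.congr_fun h f
    simpa [mul_comm] using this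
  refine LinearMap.ext_on CStarAlgebra.span_nonneg fun h hh => ?_
  replace hh : 0 ≤ h := hh
  change φ (h * coordFn N) = t * φ h
  set m : ℝ := ‖h‖ + 1
  have hm : 0 < m := by positivity
  have hk : 0 ≤ (m : ℂ) • (1 : C(spectrum ℂ N, ℂ)) - h := fun x => by
    have hx : h x = ‖h x‖ := by
      have := RCLike.norm_of_nonneg' (hh x)
      exact this.symm
    have hle := h.norm_coe_le_norm x
    change 0 ≤ (m : ℂ) * 1 - h x
    rw [mul_one, hx, ← Complex.ofReal_sub]
    exact Complex.zero_le_real.2 (by simp only [m]; linarith)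
  have real : ∀ k : C(spectrum ℂ N, ℂ), 0 ≤ k → ∃ p : ℝ, 0 ≤ p ∧ φ k = p := fun k hk => by
    have h := φ.map_nonneg hk
    exact ⟨(φ k).re, (Complex.nonneg_iff.1 h).1, Complex.eq_re_of_ofReal_le (r := 0) (by simpa using h)⟩
  obtain ⟨w, hw, hwe⟩ := exists_state_mul_coordFn φ hh
  obtain ⟨v, hv, hve⟩ := exists_state_mul_coordFn φ hk
  obtain ⟨p, hp, hpe⟩ := real _ hh
  obtain ⟨q, hq, hqe⟩ := real _ hk
  have hpq : p + q = m := by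
    have : (p : ℂ) + q = m := by rw [← hpe, ← hqe, ← map_add]; simp [h1]
    exact_mod_cast this
  have hbary : (p : ℂ) * w + q * v = m * t := by
    rw [← hpe, ← hqe, ← hwe, ← hve, ← map_add, ← add_mul, add_sub_cancel, smul_mul_assoc, one_mul,
      map_smul, hφ, smul_eq_mul]
  rw [hwe, hpe]
  rcases hp.eq_or_lt with rfl | hp
  · simp
  rcases hq.eq_or_lt with rfl | hq
  · simp only [add_zero] at hpq
    rw [Complex.ofReal_zero, zero_mul, add_zero, ← hpq] at hbary
    rw [hbary, mul_comm]
  · have hwt : w = t := ht.2 hw hv ⟨p / m, q / m, by positivity, by positivity, by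
      rw [← add_div, hpq, div_self hm.ne'], by
      have : (m : ℂ) ≠ 0 := Complex.ofReal_ne_zero.2 hm.ne'
      simp only [Complex.real_smul, Complex.ofReal_div]
      field_simp
      linear_combination hbary⟩
    rw [hwt, mul_comm]

/-- A state on `C(σ(N))` whose value at the coordinate function is extreme in the convex hull of the
spectrum is a point evaluation. -/
theorem state_eq_eval_of_mem_extremeSpectrum [Nontrivial A] (φ : C(spectrum ℂ N, ℂ) →ₚ[ℂ] ℂ)
    (h1 : φ 1 = 1) {t : spectrum ℂ N} (ht : t ∈ extremeSpectrum N) (hφ : φ (coordFn N) = t)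
    (f : C(spectrum ℂ N, ℂ)) : φ f = f t := by
  have hmul := state_mul_coordFn_of_mem_extremeSpectrum φ h1 ht hφ
  have hcont : Continuous φ := map_continuous φ
  -- Keeping the factor `g` lets the induction pass through products: the `f` satisfying this form a
  -- closed ⋆-subalgebra containing `z`, hence everything by Stone–Weierstrass.
  have key : ∀ g, φ (g * f) = φ g * f t := by
    have hf : f ∈ StarAlgebra.elemental ℂ (ContinuousMap.restrict (spectrum ℂ N) (.id ℂ)) := by
      rw [ContinuousMap.elemental_id_eq_top]
      trivial
    induction hf using StarAlgebra.elemental.induction_on with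
    | self => exact hmul
    | star_self =>
      intro g
      have := congrArg star (hmul (star g))
      rw [← map_star φ, star_mul', star_star, star_mul', ← map_star φ, star_star] at this
      exact this
    | algebraMap r =>
      intro g
      rw [Algebra.algebraMap_eq_smul_one, mul_smul_comm, mul_one, map_smul]
      simp [mul_comm]
    | add u hu v hv ihu ihv =>
      intro g
      rw [mul_add, map_add, ihu, ihv, ContinuousMap.add_apply, mul_add]
    | mul u hu v hv ihu ihv =>
      intro g
      rw [← mul_assoc, ihv, ihu, ContinuousMap.mul_apply, mul_assoc]
    | closure s hs ih v hv =>
      intro g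
      have hcl : IsClosed {v : C(spectrum ℂ N, ℂ) | φ (g * v) = φ g * v t} :=
        isClosed_eq (by fun_prop) (by fun_prop)
      exact closure_minimal (fun u hu => ih u hu g) hcl hv
  simpa [h1] using key 1

end States

/-! ### Representations of commutative C⋆-algebras -/

open scoped CStarAlgebra in
/-- An irreducible representation of `C(X)` is evaluation at a point. -/
theorem IsIrreducibleRep.exists_eq_eval {X : Type*} [MetricSpace X] [CompactSpace X] {K : Type*}
    [NormedAddCommGroup K] [InnerProductSpace ℂ K] [CompleteSpace K]
    {π : C(X, ℂ) →⋆ₐ[ℂ] (K →L[ℂ] K)} (hπ : IsIrreducibleRep π) : ∃ x, ∀ f, π f = f x • 1 := by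
  have : Nontrivial K := hπ.1
  -- By commutativity `ker (π f)` is a closed invariant subspace, so it is trivial or everything;
  -- and `f * g = 0` puts the range of `π g` inside it.
  have hdom : ∀ f g, f * g = 0 → π f = 0 ∨ π g = 0 := fun f g hfg => by
    rcases hπ.2 (LinearMap.ker (π f).toLinearMap) (π f).isClosed_ker (fun a v hv => by
      change π f (π a v) = 0
      have hv' : π f v = 0 := hv
      rw [← mul_apply_eq_comp, ← map_mul, mul_comm, map_mul,
        mul_apply_eq_comp, hv', map_zero]) with h | h
    · refine Or.inr (ContinuousLinearMap.ext fun v => ?_)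
      have hv : π g v ∈ LinearMap.ker (π f).toLinearMap := by
        change π f (π g v) = 0
        rw [← mul_apply_eq_comp, ← map_mul, hfg, map_zero]
        rfl
      rw [h] at hv
      exact hv
    · refine Or.inl (ContinuousLinearMap.ext fun v => ?_)
      have hv : v ∈ LinearMap.ker (π f).toLinearMap := h ▸ Submodule.mem_top
      exact hv
  have hcl : IsClosed (RingHom.ker π : Set C(X, ℂ)) :=
    isClosed_eq (map_continuous π)
      continuous_const
  -- A closed ideal of `C(X)` consists of the functions vanishing on a closed set. That set is
  -- nonempty since `π 1 ≠ 0`, and two points in it would contradict `hdom`.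
  have hker : ∀ f, π f = 0 ↔ ∀ x ∉ ContinuousMap.setOfIdeal (RingHom.ker π), f x = 0 := fun f => by
    rw [← RingHom.mem_ker, ← ContinuousMap.idealOfSet_ofIdeal_isClosed hcl,
      ContinuousMap.mem_idealOfSet, ContinuousMap.idealOfSet_ofIdeal_isClosed hcl]
    rfl
  obtain ⟨x, hx⟩ : ∃ x, x ∉ ContinuousMap.setOfIdeal (RingHom.ker π) := by
    by_contra! h
    have := (hker 1).2 fun x hx => absurd (h x) hx
    rw [map_one] at this
    exact one_ne_zero this
  have huniq : ∀ y ∉ ContinuousMap.setOfIdeal (RingHom.ker π), y = x := fun y hy => by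
    by_contra hne
    have hd : 0 < dist y x := dist_pos.2 hne
    -- Radius half the distance between the two points, so that the bumps have disjoint supports.
    let bump : X → C(X, ℂ) := fun p =>
      ⟨fun q => (max 0 (dist y x / 2 - dist q p) : ℝ), by fun_prop⟩
    have hb : ∀ p, bump p p ≠ 0 := fun p => by
      simp only [bump, ContinuousMap.coe_mk, dist_self, sub_zero, Ne, Complex.ofReal_eq_zero]
      exact (lt_max_of_lt_right (half_pos hd)).ne'
    have hmul : bump y * bump x = 0 := by
      ext q
      simp only [bump, ContinuousMap.mul_apply, ContinuousMap.coe_mk, ContinuousMap.zero_apply,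
        mul_eq_zero, Complex.ofReal_eq_zero, max_eq_left_iff]
      by_contra! h
      have := dist_triangle_left y x q
      linarith [h.1, h.2]
    rcases hdom _ _ hmul with h | h
    · exact hb y ((hker _).1 h y hy)
    · exact hb x ((hker _).1 h x hx)
  refine ⟨x, fun f => ?_⟩
  have h0 : π (f - f x • 1) = 0 := (hker _).2 fun y hy => by
    rw [huniq y hy]
    simp
  rwa [map_sub, map_smul, map_one, sub_eq_zero] at h0


/-! ### Completely positive maps -/

theorem smul_one_injective (K : Type*) [NormedAddCommGroup K] [InnerProductSpace ℂ K]
    [Nontrivial K] : Function.Injective fun c : ℂ => c • (1 : K →L[ℂ] K) := fun c d h => by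
  obtain ⟨v, hv⟩ := exists_ne (0 : K)
  exact smul_left_injective ℂ hv (congrArg (fun T : K →L[ℂ] K => T v) h)

section CompletelyPositive

open scoped CStarAlgebra ComplexOrder

variable {A : Type*} [CStarAlgebra A]

/-- The representation of `A` by scalars on `K` given by a character. -/
noncomputable def scalarRep (K : Type*) [NormedAddCommGroup K] [InnerProductSpace ℂ K]
    [CompleteSpace K] (χ : A →⋆ₐ[ℂ] ℂ) : A →⋆ₐ[ℂ] (K →L[ℂ] K) :=
  (StarAlgHom.ofId ℂ (K →L[ℂ] K)).comp χ

theorem scalarRep_apply (K : Type*) [NormedAddCommGroup K] [InnerProductSpace ℂ K]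
    [CompleteSpace K] (χ : A →⋆ₐ[ℂ] ℂ) (a : A) : scalarRep K χ a = χ a • 1 :=
  Algebra.algebraMap_eq_smul_one (A := K →L[ℂ] K) (χ a)

variable [PartialOrder A] [StarOrderedRing A]

/-- A convex combination of representations is completely positive. -/
theorem exists_completelyPositiveMap_sum {B : Type*} [CStarAlgebra B] [PartialOrder B]
    [StarOrderedRing B] {ι : Type*} [Fintype ι] (w : ι → ℝ) (hw : ∀ i, 0 ≤ w i)
    (π : ι → A →⋆ₐ[ℂ] B) : ∃ ψ : A →CP B, ∀ a, ψ a = ∑ i, (w i : ℂ) • π i a := by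
  have hs : ∀ a, (∑ i, (w i : ℂ) • ((π i).toAlgHom.toLinearMap : A →ₗ[ℂ] B)) a =
      ∑ i, (w i : ℂ) • π i a := fun a => by
    rw [LinearMap.sum_apply]
    rfl
  refine ⟨⟨∑ i, (w i : ℂ) • ((π i).toAlgHom.toLinearMap : A →ₗ[ℂ] B), fun k M hM => ?_⟩, hs⟩
  have hsum : 0 ≤ ∑ i, (w i : ℂ) • M.map (π i) :=
    Finset.sum_nonneg fun i _ => smul_nonneg (Complex.zero_le_real.2 (hw i))
      (CompletelyPositiveMapClass.map_cstarMatrix_nonneg' (π i) k M hM)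
  convert hsum using 1
  ext p q
  have happ : ∀ s : Finset ι, (∑ i ∈ s, (w i : ℂ) • M.map (π i)) p q =
      ∑ i ∈ s, (w i : ℂ) • π i (M p q) := fun s => by
    classical
    induction s using Finset.induction_on with
    | empty => rfl
    | insert i s hi ih => rw [Finset.sum_insert hi, Finset.sum_insert hi, ← ih]; rfl
  rw [happ]
  exact hs (M p q)

/-- The positive functional `a ↦ ⟪v, ψ a v⟫` of a completely positive map. -/
theorem exists_vectorState {K : Type*} [NormedAddCommGroup K] [InnerProductSpace ℂ K]
    [CompleteSpace K] (ψ : A →CP (K →L[ℂ] K)) (v : K) :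
    ∃ φ : A →ₚ[ℂ] ℂ, ∀ a, φ a = inner ℂ v (ψ a v) :=
  ⟨PositiveLinearMap.mk₀ ((innerSL ℂ v).toLinearMap ∘ₗ
      (ContinuousLinearMap.apply ℂ K v).toLinearMap ∘ₗ ψ.toLinearMap) fun a ha => by
    have h : 0 ≤ ψ a := by simpa using OrderHomClass.mono ψ ha
    exact ((ContinuousLinearMap.nonneg_iff_isPositive _).1 h).inner_nonneg_right v,
    fun _ => rfl⟩

theorem state_eq_of_mem_extremeSpectrum {C : Type*} [CStarAlgebra C] [Nontrivial C] {N : C}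
    (Γ : A ≃⋆ₐ[ℂ] C(spectrum ℂ N, ℂ)) (φ : A →ₚ[ℂ] ℂ) (h1 : φ 1 = 1)
    {t : spectrum ℂ N} (ht : t ∈ extremeSpectrum N) {x : A} (hx : Γ x = coordFn N)
    (hφ : φ x = t) (a : A) : φ a = Γ a t := by
  let φ' : C(spectrum ℂ N, ℂ) →ₚ[ℂ] ℂ := PositiveLinearMap.mk₀
    (φ.toLinearMap ∘ₗ (Γ.symm : C(spectrum ℂ N, ℂ) →⋆ₐ[ℂ] A).toAlgHom.toLinearMap)
    fun f hf => φ.map_nonneg (map_nonneg Γ.symm hf)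
  have hφ' : ∀ f, φ' f = φ (Γ.symm f) := fun _ => rfl
  have := state_eq_eval_of_mem_extremeSpectrum φ' (by rw [hφ', map_one, h1]) ht
    (by rw [hφ', ← hx, StarAlgEquiv.symm_apply_apply, hφ]) (Γ a)
  rwa [hφ', StarAlgEquiv.symm_apply_apply] at this

/-- A completely positive map into the operators on a one-dimensional Hilbert space is given by a
positive functional. -/
theorem exists_eq_smul_one_of_completelyPositiveMap {ι : Type*} [Unique ι]
    (ψ : A →CP (EuclideanSpace ℂ ι →L[ℂ] EuclideanSpace ℂ ι)) :
    ∃ φ : A →ₚ[ℂ] ℂ, ∀ a, ψ a = φ a • 1 := by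
  classical
  obtain ⟨φ, hφ⟩ := exists_vectorState ψ (EuclideanSpace.single default 1)
  refine ⟨φ, fun a => ?_⟩
  rw [hφ]
  ext v i
  have hv : v = v default • EuclideanSpace.single default (1 : ℂ) := by
    ext j
    simp [Unique.eq_default j]
  conv_lhs => rw [hv, map_smul]
  simp [EuclideanSpace.inner_single_left, Unique.eq_default i, mul_comm]

end CompletelyPositive

/-! ### The boundary representations of `𝒮_N` -/

section BoundaryReps

open scoped CStarAlgebra ComplexOrder

universe u

variable {H : Type u} [NormedAddCommGroup H] [InnerProductSpace ℂ H] [CompleteSpace H]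

theorem cstarGen_operatorSystem (N : H →L[ℂ] H) :
    cstarGen (operatorSystem N) = StarAlgebra.elemental ℂ N := by
  refine le_antisymm (StarSubalgebra.topologicalClosure_minimal (StarAlgebra.adjoin_le ?_)
    (StarAlgebra.elemental.isClosed ℂ N)) (StarAlgebra.elemental.le_of_mem
      (StarSubalgebra.isClosed_topologicalClosure _)
      (le_cstarGen _ (operatorSystem.gen N).2))
  have : operatorSystem N ≤ (StarAlgebra.elemental ℂ N).toSubalgebra.toSubmodule := by
    refine Submodule.span_le.2 ?_
    rintro _ (rfl | rfl | rfl)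
    · exact one_mem (StarAlgebra.elemental ℂ N)
    · exact StarAlgebra.elemental.self_mem ℂ _
    · exact StarAlgebra.elemental.star_self_mem ℂ _
  exact this

variable (N : H →L[ℂ] H) [IsStarNormal N]

/-- `S` is a variable so that the equality can be substituted away; `C⋆(𝒮_N)` is only
propositionally equal to `StarAlgebra.elemental ℂ N`. -/
theorem exists_starAlgEquiv_of_eq_elemental {A : Type*} [CStarAlgebra A] (a : A) [IsStarNormal a]
    (S : StarSubalgebra ℂ A) (h : StarAlgebra.elemental ℂ a = S) (ha : a ∈ S) :
    ∃ Γ : S ≃⋆ₐ[ℂ] C(spectrum ℂ a, ℂ), Γ ⟨a, ha⟩ = coordFn a := by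
  subst h
  refine ⟨(continuousFunctionalCalculus a).symm, ?_⟩
  rw [← continuousFunctionalCalculus_map_id a]
  exact (continuousFunctionalCalculus a).symm_apply_apply _

/-- The Gelfand transform `C⋆(𝒮_N) ≃ C(σ(N))`. -/
noncomputable def gelfandOperatorSystem :
    cstarGen (operatorSystem N) ≃⋆ₐ[ℂ] C(spectrum ℂ N, ℂ) :=
  (exists_starAlgEquiv_of_eq_elemental N _ (cstarGen_operatorSystem N).symm
    (le_cstarGen _ (operatorSystem.gen N).2)).choose

theorem gelfandOperatorSystem_gen :
    gelfandOperatorSystem N (inclGen _ (operatorSystem.gen N)) = coordFn N :=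
  (exists_starAlgEquiv_of_eq_elemental N _ (cstarGen_operatorSystem N).symm
    (le_cstarGen _ (operatorSystem.gen N).2)).choose_spec

theorem gelfandOperatorSystem_mem (x : operatorSystem N) :
    gelfandOperatorSystem N (inclGen _ x) ∈ functionSystem N := by
  obtain ⟨x, hx⟩ := x
  obtain ⟨a, b, c, rfl⟩ := Submodule.mem_span_triple.1 hx
  refine Submodule.mem_span_triple.2 ⟨a, b, c, ?_⟩
  have h : inclGen _ ⟨a • 1 + b • N + c • star N, hx⟩ =
      a • (1 : cstarGen (operatorSystem N)) + b • inclGen _ (operatorSystem.gen N)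
        + c • star (inclGen _ (operatorSystem.gen N)) := rfl
  rw [h, map_add, map_add, map_smul, map_smul, map_smul, map_star, map_one,
    gelfandOperatorSystem_gen]

/-- The character of `C⋆(𝒮_N)` given by a point of the spectrum. -/
noncomputable def characterOfSpectrum (t : spectrum ℂ N) : cstarGen (operatorSystem N) →⋆ₐ[ℂ] ℂ :=
  (ContinuousMap.evalStarAlgHom ℂ ℂ t).comp
    (gelfandOperatorSystem N : cstarGen (operatorSystem N) →⋆ₐ[ℂ] C(spectrum ℂ N, ℂ))

theorem characterOfSpectrum_apply (t : spectrum ℂ N) (a : cstarGen (operatorSystem N)) :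
    characterOfSpectrum N t a = gelfandOperatorSystem N a t :=
  rfl

/-- Boundary representations of `𝒮_N` annihilate the elements whose Gelfand transform vanishes on
the closure of the extreme points. -/
theorem IsBoundaryRep.eq_zero_of_vanishing {K : Type*} [NormedAddCommGroup K]
    [InnerProductSpace ℂ K] [CompleteSpace K]
    {ρ : cstarGen (operatorSystem N) →⋆ₐ[ℂ] (K →L[ℂ] K)} (hρ : IsBoundaryRep _ ρ)
    {a : cstarGen (operatorSystem N)}
    (ha : ∀ t ∈ closure (extremeSpectrum N), gelfandOperatorSystem N a t = 0) : ρ a = 0 := by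
  have hirr : IsIrreducibleRep (ρ.comp ((gelfandOperatorSystem N).symm :
      C(spectrum ℂ N, ℂ) →⋆ₐ[ℂ] cstarGen (operatorSystem N))) :=
    ⟨hρ.1.1, fun V hV h => hρ.1.2 V hV fun b v hv => by
      have := h (gelfandOperatorSystem N b) v hv
      rwa [StarAlgHom.comp_apply, StarAlgHom.coe_coe, StarAlgEquiv.symm_apply_apply] at this⟩
  obtain ⟨x, hx⟩ := hirr.exists_eq_eval
  have hρx : ∀ b, ρ b = gelfandOperatorSystem N b x • 1 := fun b => by
    have := hx (gelfandOperatorSystem N b)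
    rwa [StarAlgHom.comp_apply, StarAlgHom.coe_coe, StarAlgEquiv.symm_apply_apply] at this
  -- It is not needed that `x` itself lies in the closure: the averaged evaluation `ψ` agrees with
  -- `ρ` on `𝒮_N`, so `ρ = ψ`, which sees only values on the closure.
  obtain ⟨ι, _, w, e, hw0, hw1, he, h⟩ := exists_convexCombination_functionSystem N x
  obtain ⟨ψ, hψ⟩ := exists_completelyPositiveMap_sum w hw0
    fun i => scalarRep K (characterOfSpectrum N (e i))
  replace hψ : ∀ b, ψ b = (∑ i, (w i : ℂ) * gelfandOperatorSystem N b (e i)) • 1 := fun b => by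
    simp only [hψ, scalarRep_apply, characterOfSpectrum_apply, Finset.sum_smul, mul_smul]
  rw [← hρ.2 ψ ?_ (fun y => ?_) a, hψ]
  · simp only [ha _ (he _), mul_zero, Finset.sum_const_zero, zero_smul]
  · rw [hψ, map_one]
    simp [← Complex.ofReal_sum, hw1]
  · rw [hψ, hρx, h _ (gelfandOperatorSystem_mem N y)]

/-- A competing completely positive map is `φ • 1` for a state `φ` with `φ N = t`, and extremality
of `t` makes `φ` the evaluation. `PUnit.{u + 1}` puts the one-dimensional space in the universe over
which `silovIdeal` quantifies. -/
theorem isBoundaryRep_scalarRep [Nontrivial H] {t : spectrum ℂ N} (ht : t ∈ extremeSpectrum N) :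
    IsBoundaryRep (operatorSystem N)
      (scalarRep (EuclideanSpace ℂ PUnit.{u + 1}) (characterOfSpectrum N t)) := by
  have hfin : Module.finrank ℂ (EuclideanSpace ℂ PUnit.{u + 1}) = 1 := by simp
  have hnt : Nontrivial (EuclideanSpace ℂ PUnit.{u + 1}) :=
    Module.nontrivial_of_finrank_eq_succ hfin
  refine ⟨⟨hnt, fun V _ _ => ?_⟩, fun ψ h1 hψ a => ?_⟩
  · have : IsSimpleModule ℂ (EuclideanSpace ℂ PUnit.{u + 1}) :=
      isSimpleModule_iff_finrank_eq_one.2 hfin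
    exact eq_bot_or_eq_top V
  · obtain ⟨φ, hφ⟩ := exists_eq_smul_one_of_completelyPositiveMap ψ
    have hinj := smul_one_injective (EuclideanSpace ℂ PUnit.{u + 1})
    have hunit : φ 1 = 1 := hinj (by simp only [← hφ, h1, one_smul])
    have hz : φ (inclGen _ (operatorSystem.gen N)) = t := hinj <| by
      simp only [← hφ, hψ, scalarRep_apply, characterOfSpectrum_apply, gelfandOperatorSystem_gen]
      rfl
    rw [hφ, scalarRep_apply, characterOfSpectrum_apply,
      state_eq_of_mem_extremeSpectrum (gelfandOperatorSystem N) φ hunit ht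
        (gelfandOperatorSystem_gen N) hz]

/-- The Šilov ideal of `𝒮_N` consists of the elements whose Gelfand transform vanishes on the
Šilov boundary. -/
theorem mem_silovIdeal_operatorSystem [Nontrivial H] {a : cstarGen (operatorSystem N)} :
    a ∈ silovIdeal (operatorSystem N) ↔
      ∀ t ∈ silovBoundary (functionSystem N : Set C(spectrum ℂ N, ℂ)),
        gelfandOperatorSystem N a t = 0 := by
  rw [silovBoundary_functionSystem]
  refine ⟨fun h => ?_, fun h K _ _ _ ρ hρ => hρ.eq_zero_of_vanishing N h⟩
  -- The zero set of a continuous function is closed, so the extreme points themselves suffice.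
  refine closure_minimal (fun t ht => ?_)
    (isClosed_eq (gelfandOperatorSystem N a).continuous continuous_const)
  have h0 := h _ _ (isBoundaryRep_scalarRep N ht)
  have hnt : Nontrivial (EuclideanSpace ℂ PUnit.{u + 1}) :=
    (isBoundaryRep_scalarRep N ht).1.1
  refine smul_one_injective (EuclideanSpace ℂ PUnit.{u + 1}) ?_
  simpa only [scalarRep_apply, characterOfSpectrum_apply, zero_smul] using h0

end BoundaryReps

/-! ### The C⋆-envelope of `𝒮_N` -/

section Envelope

/-- A surjective ⋆-homomorphism with kernel `I` induces an isomorphism from the quotient by `I`. -/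
theorem exists_starAlgEquiv_quotient {A B : Type*} [CStarAlgebra A] [Ring B] [StarRing B]
    [Algebra ℂ B] (I : Ideal A) [I.IsTwoSided] [IsClosed (I : Set A)] (q : A →⋆ₐ[ℂ] B)
    (hq : Function.Surjective q) (hI : ∀ a, a ∈ I ↔ q a = 0) :
    ∃ Φ : (A ⧸ I) ≃⋆ₐ[ℂ] B, ∀ a, Φ (Ideal.Quotient.mk I a) = q a := by
  let F : (A ⧸ I) →⋆ₐ[ℂ] B :=
    { Ideal.Quotient.liftₐ I q.toAlgHom fun a ha => (hI a).1 ha with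
      map_star' := by
        rintro ⟨a⟩
        exact map_star q a }
  have hF : ∀ a, F (Ideal.Quotient.mk I a) = q a := fun _ => rfl
  refine ⟨StarAlgEquiv.ofBijective F ⟨(injective_iff_map_eq_zero F).2 ?_, fun b => ?_⟩, hF⟩
  · intro x hx
    obtain ⟨a, rfl⟩ := Ideal.Quotient.mk_surjective x
    exact Ideal.Quotient.eq_zero_iff_mem.2 ((hI a).2 hx)
  · obtain ⟨a, rfl⟩ := hq b
    exact ⟨_, hF a⟩

open scoped ComplexOrder

/-- The norm of a matrix over a C⋆-algebra of functions is the supremum of the pointwise norms. -/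
theorem CStarMatrix.norm_ofMatrix_le_iff {A : Type*} [CStarAlgebra A] [PartialOrder A]
    [StarOrderedRing A] {X : Type*} [TopologicalSpace X] [CompactSpace X] (Ψ : A ≃⋆ₐ[ℂ] C(X, ℂ))
    {n : ℕ} (M : Matrix (Fin n) (Fin n) A) {C : ℝ} (hC : 0 ≤ C) :
    ‖CStarMatrix.ofMatrix M‖ ≤ C ↔
      ∀ x, ‖CStarMatrix.ofMatrix (M.map fun a => Ψ a x)‖ ≤ C := by
  -- Entrywise evaluation embeds the matrices in `C(X, Mₙ(ℂ))`; an injective ⋆-homomorphism of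
  -- C⋆-algebras is isometric.
  let F : CStarMatrix (Fin n) (Fin n) A →⋆ₙₐ[ℂ] C(X, CStarMatrix (Fin n) (Fin n) ℂ) :=
    { toFun := fun M => ⟨fun x => CStarMatrix.ofMatrix fun i j => Ψ (M i j) x,
        continuous_pi fun i => continuous_pi fun j => (Ψ (M i j)).continuous⟩
      map_smul' := fun c M => by
        ext x i j
        exact congrArg (· x) (map_smul Ψ c (M i j))
      map_zero' := by
        ext x i j
        exact congrArg (· x) (map_zero Ψ)
      map_add' := fun M N => by
        ext x i j
        exact congrArg (· x) (map_add Ψ (M i j) (N i j))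
      map_mul' := fun M N => by
        ext x i j
        change Ψ ((M * N) i j) x = ∑ k, Ψ (M i k) x * Ψ (N k j) x
        rw [CStarMatrix.mul_apply, map_sum, ContinuousMap.sum_apply]
        simp only [map_mul, ContinuousMap.mul_apply]
      map_star' := fun M => by
        ext x i j
        exact congrArg (· x) (map_star Ψ (M j i)) }
  have hF : Function.Injective F := fun M N h => by
    ext i j
    refine Ψ.injective (ContinuousMap.ext fun x => ?_)
    exact congrArg (fun G : C(X, CStarMatrix (Fin n) (Fin n) ℂ) => G x i j) h
  rw [← NonUnitalStarAlgHom.norm_map F hF, ContinuousMap.norm_le _ hC]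
  rfl

/-- An injective ⋆-homomorphism preserves the norms of matrices. -/
theorem CStarMatrix.norm_map_of_injective {A B : Type*} [CStarAlgebra A] [PartialOrder A]
    [StarOrderedRing A] [CStarAlgebra B] [PartialOrder B] [StarOrderedRing B] (Ψ : A →⋆ₐ[ℂ] B)
    (hΨ : Function.Injective Ψ) {n : ℕ} (M : Matrix (Fin n) (Fin n) A) :
    ‖CStarMatrix.ofMatrix (M.map Ψ)‖ = ‖CStarMatrix.ofMatrix M‖ :=
  NonUnitalStarAlgHom.norm_map (CStarMatrix.mapₙₐ (n := Fin n) (Ψ : A →⋆ₙₐ[ℂ] B))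
    (CStarMatrix.map_injective hΨ) (CStarMatrix.ofMatrix M)

/-- The norm of a matrix over `Span {1, z, z̄}` at a point is bounded by its norms at the points in
the closure of the extreme points. -/
theorem norm_matrix_functionSystem_le {A : Type*} [CStarAlgebra A] (N : A) {n : ℕ}
    (M : Matrix (Fin n) (Fin n) (functionSystem N)) {C : ℝ}
    (hC : ∀ e ∈ closure (extremeSpectrum N),
      ‖CStarMatrix.ofMatrix (M.map fun f => (f : C(spectrum ℂ N, ℂ)) e)‖ ≤ C)
    (t : spectrum ℂ N) :
    ‖CStarMatrix.ofMatrix (M.map fun f => (f : C(spectrum ℂ N, ℂ)) t)‖ ≤ C := by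
  obtain ⟨ι, _, w, e, hw0, hw1, he, h⟩ := exists_convexCombination_functionSystem N t
  have hM : CStarMatrix.ofMatrix (M.map fun f => (f : C(spectrum ℂ N, ℂ)) t) =
      ∑ i, (w i : ℂ) • CStarMatrix.ofMatrix (M.map fun f => (f : C(spectrum ℂ N, ℂ)) (e i)) := by
    have happ : ∀ (s : Finset ι) (p q : Fin n), (∑ i ∈ s, (w i : ℂ) •
        CStarMatrix.ofMatrix (M.map fun f => (f : C(spectrum ℂ N, ℂ)) (e i))) p q =
        ∑ i ∈ s, (w i : ℂ) * (M p q : C(spectrum ℂ N, ℂ)) (e i) := fun s p q => by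
      classical
      induction s using Finset.induction_on with
      | empty => rfl
      | insert i s hi ih => rw [Finset.sum_insert hi, Finset.sum_insert hi, ← ih]; rfl
    ext p q
    rw [happ]
    exact h _ (M p q).2
  calc _ ≤ ∑ i, w i * C := by
        rw [hM]
        refine (norm_sum_le _ _).trans (Finset.sum_le_sum fun i _ => ?_)
        rw [norm_smul, Complex.norm_real, Real.norm_of_nonneg (hw0 i)]
        exact mul_le_mul_of_nonneg_left (hC _ (he i)) (hw0 i)
    _ = C := by rw [← Finset.sum_mul, hw1, one_mul]

variable {H : Type*} [NormedAddCommGroup H] [InnerProductSpace ℂ H] [CompleteSpace H]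

/-- Gelfand transform followed by restriction to the Šilov boundary: surjective by Tietze, with
kernel the Šilov ideal. -/
theorem exists_envelope_equiv [Nontrivial H] (N : H →L[ℂ] H) [IsStarNormal N] :
    ∃ Φ : CStarEnvelope (operatorSystem N) ≃⋆ₐ[ℂ]
        C(silovBoundary (functionSystem N : Set C(spectrum ℂ N, ℂ)), ℂ),
      ∀ a t, Φ (Ideal.Quotient.mk _ a) t = gelfandOperatorSystem N a t := by
  have hcl : IsClosed (silovBoundary (functionSystem N : Set C(spectrum ℂ N, ℂ))) := by
    rw [silovBoundary_functionSystem]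
    exact isClosed_closure
  let q : cstarGen (operatorSystem N) →⋆ₐ[ℂ]
      C(silovBoundary (functionSystem N : Set C(spectrum ℂ N, ℂ)), ℂ) :=
    (ContinuousMap.compStarAlgHom' ℂ ℂ ⟨Subtype.val, continuous_subtype_val⟩).comp
      (gelfandOperatorSystem N : cstarGen (operatorSystem N) →⋆ₐ[ℂ] C(spectrum ℂ N, ℂ))
  have hqa : ∀ a t, q a t = gelfandOperatorSystem N a t := fun _ _ => rfl
  obtain ⟨Φ, hΦ⟩ := exists_starAlgEquiv_quotient (silovIdeal (operatorSystem N)) q (fun g => by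
    obtain ⟨f, hf⟩ := ContinuousMap.exists_restrict_eq hcl g
    obtain ⟨a, rfl⟩ := (gelfandOperatorSystem N).surjective f
    exact ⟨a, hf⟩) fun a => by
      rw [mem_silovIdeal_operatorSystem]
      exact ⟨fun h => ContinuousMap.ext fun t => h t t.2, fun h t ht =>
        (hqa a ⟨t, ht⟩).symm.trans (by rw [h]; rfl)⟩
  exact ⟨Φ, fun a t => by rw [hΦ, hqa]⟩

/-- Both matrix norms are suprema of pointwise norms, over the Šilov boundary and over the whole
spectrum. They agree because values of the matrix on the spectrum are convex combinations of its
values on the Šilov boundary. -/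
theorem hasNoncommutativeChoquetBoundary_operatorSystem [Nontrivial H] (N : H →L[ℂ] H)
    [IsStarNormal N] : HasNoncommutativeChoquetBoundary (operatorSystem N) := by
  intro n M
  obtain ⟨Φ, hΦ⟩ := exists_envelope_equiv N
  have hcl : IsClosed (silovBoundary (functionSystem N : Set C(spectrum ℂ N, ℂ))) := by
    rw [silovBoundary_functionSystem]
    exact isClosed_closure
  have : CompactSpace (silovBoundary (functionSystem N : Set C(spectrum ℂ N, ℂ))) :=
    isCompact_iff_compactSpace.1 hcl.isCompact
  have h1 : ∀ C : ℝ, 0 ≤ C →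
      (‖CStarMatrix.ofMatrix (M.map fun x => toEnvelope (operatorSystem N) x)‖ ≤ C ↔
      ∀ t : silovBoundary (functionSystem N : Set C(spectrum ℂ N, ℂ)),
        ‖CStarMatrix.ofMatrix (M.map fun x => gelfandOperatorSystem N (inclGen _ x) t)‖ ≤ C) :=
    fun C hC => by
      rw [CStarMatrix.norm_ofMatrix_le_iff Φ _ hC]
      refine forall_congr' fun t => ?_
      have : (M.map fun x => toEnvelope (operatorSystem N) x).map (fun a => Φ a t) =
          M.map fun x => gelfandOperatorSystem N (inclGen _ x) t := by
        ext i j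
        exact hΦ _ t
      exact iff_of_eq (congrArg (fun K => ‖CStarMatrix.ofMatrix K‖ ≤ C) this)
  have h2 : ‖CStarMatrix.ofMatrix (M.map fun x => (x : H →L[ℂ] H))‖ =
      ‖CStarMatrix.ofMatrix (M.map fun x => inclGen _ x)‖ :=
    CStarMatrix.norm_map_of_injective (cstarGen (operatorSystem N)).subtype
      Subtype.val_injective (M.map fun x => inclGen _ x)
  have h3 : ∀ C : ℝ, 0 ≤ C →
      (‖CStarMatrix.ofMatrix (M.map fun x => inclGen (operatorSystem N) x)‖ ≤ C ↔
      ∀ t, ‖CStarMatrix.ofMatrix (M.map fun x => gelfandOperatorSystem N (inclGen _ x) t)‖ ≤ C) :=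
    fun C hC => CStarMatrix.norm_ofMatrix_le_iff (gelfandOperatorSystem N) _ hC
  rw [h2]
  refine le_antisymm ((h1 _ (norm_nonneg _)).2 fun t => (h3 _ (norm_nonneg _)).1 le_rfl t)
    ((h3 _ (norm_nonneg _)).2 ?_)
  refine norm_matrix_functionSystem_le N
    (M.map fun x => ⟨gelfandOperatorSystem N (inclGen _ x), gelfandOperatorSystem_mem N x⟩)
    fun e he => ?_
  rw [← silovBoundary_functionSystem] at he
  exact (h1 _ (norm_nonneg _)).1 le_rfl ⟨e, he⟩

end Envelope

theorem mainTheorem8 {H : Type*} [NormedAddCommGroup H] [InnerProductSpace ℂ H] [CompleteSpace H]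
    [Nontrivial H] (N : H →L[ℂ] H) (hN : IsStarNormal N) :
    HasNoncommutativeChoquetBoundary (operatorSystem N) ∧
    IsLeast {B : Set (spectrum ℂ N) | IsFunctionBoundary (functionSystem N : Set C(spectrum ℂ N, ℂ)) B}
      (silovBoundary (functionSystem N : Set C(spectrum ℂ N, ℂ))) ∧
    ∃ Φ : CStarEnvelope (operatorSystem N) ≃⋆ₐ[ℂ]
        C(silovBoundary (functionSystem N : Set C(spectrum ℂ N, ℂ)), ℂ),
      ∀ t, Φ (toEnvelope (operatorSystem N) (operatorSystem.gen N)) t = (t : spectrum ℂ N) := by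
  refine ⟨hasNoncommutativeChoquetBoundary_operatorSystem N, ⟨?_, fun B hB =>
    Set.sInter_subset_of_mem hB⟩, ?_⟩
  · rw [silovBoundary_functionSystem]
    exact isFunctionBoundary_closure_extremeSpectrum N
  · obtain ⟨Φ, hΦ⟩ := exists_envelope_equiv N
    refine ⟨Φ, fun t => (hΦ _ t).trans ?_⟩
    rw [gelfandOperatorSystem_gen]
    rfl
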